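/- All graphs are finite and simple. An edge labeling of a graph $H$ with $d$ labels is an arbitrary map $E(H)\to\{1,\dots,d\}$, and it is *distinguishing* if the identity is the only automorphism of $H$ that preserves the labels of all edges. The *distinguishing index* $D'(H)$ is the least $d$ for which $H$ has a distinguishing edge labeling with $d$ labels. For a vertex $x$ of a graph $G$, let $N[x]$ be the closed neighborhood of $x$, that is, the set consisting of $x$ and all its neighbors; $G$ is *$S$-thin* if $N[x]\neq N[y]$ for all distinct vertices $x,y$. The *$k$-th strong power* $\boxtimes G^k$ has vertex set $V(G)^k$, and two distinct vertices $(x_1,\dots,x_k)$ and $(y_1,\dots,y_k)$ are adjacent if and only if, for every $i$, either $x_i=y_i$ or $x_iy_i\in E(G)$. **Corollary.** Let $G$ be a connected $S$-thin graph with at least two vertices. Then $D'(\boxtimes G^k)=2$ for every $k\ge 2$. -/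

import Mathlib

namespace SimpleGraph

/-- The strong product of two graphs: the union of the edges of the Cartesian product and
of the direct product, on the vertex set `V × W`. -/
def strongProd {V W : Type*} (G : SimpleGraph V) (H : SimpleGraph W) : SimpleGraph (V × W) where
  Adj x y := (G □ H).Adj x y ∨ (G.Adj x.1 y.1 ∧ H.Adj x.2 y.2)
  symm := ⟨fun _ _ h => h.imp (fun h => h.symm) (fun h => ⟨h.1.symm, h.2.symm⟩)⟩
  loopless := ⟨fun _ h => h.elim (fun h => h.ne rfl) (fun h => h.1.ne rfl)⟩

/-- The `k`-th strong power of `G`: its vertices are the `k`-tuples of vertices of `G`, and two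
distinct tuples are adjacent when in every coordinate they are equal or adjacent in `G`. -/
def strongPower {V : Type*} (G : SimpleGraph V) (k : ℕ) : SimpleGraph (Fin k → V) where
  Adj x y := x ≠ y ∧ ∀ i, G.Adj (x i) (y i) ∨ x i = y i
  symm := ⟨fun _ _ h => ⟨h.1.symm, fun i => (h.2 i).imp (fun h => h.symm) (fun h => h.symm)⟩⟩
  loopless := ⟨fun _ h => h.1 rfl⟩

/-- The first strong power of `G` is `G`. -/
theorem strongPower_one {V : Type*} (G : SimpleGraph V) (x y : Fin 1 → V) :
    (G.strongPower 1).Adj x y ↔ G.Adj (x 0) (y 0) := by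
  simp only [strongPower, Fin.forall_fin_one, ne_eq, funext_iff]
  constructor
  · rintro ⟨h, h' | h'⟩
    · exact h'
    · exact absurd h' h
  · exact fun h => ⟨h.ne, Or.inl h⟩

/-- The `(k + 1)`-st strong power of `G` is the strong product of `G` and its `k`-th strong
power, tuples being split into their first entry and the rest. -/
theorem strongPower_succ {V : Type*} (G : SimpleGraph V) (k : ℕ) (x y : Fin (k + 1) → V) :
    (G.strongPower (k + 1)).Adj x y ↔
      (G.strongProd (G.strongPower k)).Adj (x 0, Fin.tail x) (y 0, Fin.tail y) := by
  have hxy : x = y ↔ x 0 = y 0 ∧ Fin.tail x = Fin.tail y := by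
    simp only [funext_iff, Fin.forall_fin_succ, Fin.tail]
  have ht : (∀ i, G.Adj (Fin.tail x i) (Fin.tail y i) ∨ Fin.tail x i = Fin.tail y i) ↔
      (∀ i : Fin k, G.Adj (x i.succ) (y i.succ) ∨ x i.succ = y i.succ) := Iff.rfl
  have hr : Fin.tail x = Fin.tail y →
      ∀ i : Fin k, G.Adj (x i.succ) (y i.succ) ∨ x i.succ = y i.succ :=
    fun h i => Or.inr (congrFun h i)
  have hne : G.Adj (x 0) (y 0) → x 0 ≠ y 0 := fun h => h.ne
  simp only [strongPower, strongProd, boxProd_adj, Fin.forall_fin_succ, ne_eq, hxy, ht]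
  tauto

/-- The closed neighborhood `N[x]` of a vertex. -/
def closedNbhd {V : Type*} (G : SimpleGraph V) (x : V) : Set V :=
  insert x (G.neighborSet x)

/-- A graph is `S`-thin if no two distinct vertices have the same closed neighborhood. -/
def IsSThin {V : Type*} (G : SimpleGraph V) : Prop :=
  ∀ x y : V, G.closedNbhd x = G.closedNbhd y → x = y

/-- An edge labeling is distinguishing if the identity is the only automorphism of the graph
that preserves the labels of all edges. -/
def IsDistinguishingEdgeLabeling {V K : Type*} (G : SimpleGraph V)
    (c : G.EdgeLabeling K) : Prop :=
  ∀ φ : G ≃g G, (∀ e : G.edgeSet, c (φ.mapEdgeSet e) = c e) → φ = RelIso.refl G.Adj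

/-- The distinguishing index `D'(G)`: the least number `d` of labels for which `G` has a
distinguishing edge labeling. The infimum is `0` when there is no such labeling; a
positive value is always attained. -/
noncomputable def distinguishingIndex {V : Type*} (G : SimpleGraph V) : ℕ :=
  sInf {d : ℕ | ∃ c : G.EdgeLabeling (Fin d), G.IsDistinguishingEdgeLabeling c}

end SimpleGraph

namespace SimpleGraph

/-! Two labels encode a subgraph, so it suffices to find a `linkGraph` inside the strong power such
that only the identity preserves both graphs (`map_eq`). One label is too few, since swapping two
coordinates is a nontrivial automorphism.

Root `G` at a vertex of maximum degree; S-thinness serves only to make this degree at least 2. In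
the link graph the origin is the unique vertex with a single neighbor and is attached to the end of
a path through all near axial tuples. Each other near tuple is joined to its axial projections, each
far tuple to its lowerings, and each far axial tuple also to its mark.

An automorphism of both graphs fixes the origin, hence preserves the set of near tuples. Counting
near neighbors singles out the path, which is then fixed from its end (`map_trail`), and projections
fix the other near tuples (`map_of_isNear`). The rest is induction on the sum of depths: two
lowerings determine a nonaxial tuple (`eq_of_lower_eq`), while an axial one is determined by its
lowering and its mark, which separates siblings (`mark_inj`). -/

/-- A rooting of a graph at a vertex `root`: depths and parents of a breadth-first spanning tree,
an enumeration of the neighbors of the root, and for each vertex an injective coding of its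
neighbors by neighbors of the root. -/
structure Rooting {V : Type*} (G : SimpleGraph V) where
  root : V
  depth : V → ℕ
  parent : V → V
  code : V → V → V
  enum : ℕ → V
  deg : ℕ
  depth_eq_zero : ∀ x, depth x = 0 ↔ x = root
  depth_eq_one : ∀ x, depth x = 1 ↔ G.Adj root x
  adj_parent : ∀ x, x ≠ root → G.Adj x (parent x)
  depth_parent : ∀ x, x ≠ root → depth (parent x) + 1 = depth x
  code_adj : ∀ a b, G.Adj a b → G.Adj root (code a b)
  code_inj : ∀ a b c, G.Adj a b → G.Adj a c → code a b = code a c → b = c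
  two_le_deg : 2 ≤ deg
  enum_adj : ∀ i, i < deg → G.Adj root (enum i)
  enum_inj : ∀ i j, i < deg → j < deg → enum i = enum j → i = j
  enum_surj : ∀ s, G.Adj root s → ∃ i, i < deg ∧ enum i = s

/-! ### Rooting at a vertex of maximum degree. -/

theorem Rooting.nonempty_of_isSThin {V : Type*} [Finite V] [Nontrivial V] {G : SimpleGraph V}
    (hconn : G.Connected) (hthin : G.IsSThin) : Nonempty G.Rooting := by
  classical
  have := Fintype.ofFinite V
  obtain ⟨r, hr⟩ := G.exists_maximal_degree_vertex
  have hdeg : ∀ x, G.degree x ≤ G.degree r := fun x => hr ▸ G.degree_le_maxDegree x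
  -- With maximum degree at most 1, both ends of an edge would have that edge as closed
  -- neighborhood.
  have h2 : 2 ≤ G.degree r := by
    by_contra hlt
    have h1 : ∀ x y z, G.Adj x y → G.Adj x z → z = y := by
      intro x y z hy hz
      have : (G.neighborFinset x).card ≤ 1 := by
        have := hdeg x
        rw [← card_neighborFinset_eq_degree] at this
        omega
      exact Finset.card_le_one.1 this z (by simpa using hz) y (by simpa using hy)
    obtain ⟨y, hy⟩ := hconn.preconnected.exists_adj_of_nontrivial r
    have key : ∀ a b, G.Adj a b → G.closedNbhd a = {a, b} := by
      intro a b hab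
      ext z
      simp only [closedNbhd, Set.mem_insert_iff, mem_neighborSet, Set.mem_singleton_iff]
      exact or_congr_right ⟨fun h => h1 a b z hab h, fun h => h ▸ hab⟩
    refine hy.ne (hthin _ _ ?_)
    rw [key _ _ hy, key _ _ hy.symm, Set.pair_comm]
  have hpar : ∀ x, ∃ y, x ≠ r → G.Adj x y ∧ G.dist r y + 1 = G.dist r x := by
    intro x
    by_cases hx : x = r
    · exact ⟨x, fun h => absurd hx h⟩
    obtain ⟨w, hw⟩ := (hconn x r).exists_walk_length_eq_dist
    cases w with
    | nil => exact absurd rfl hx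
    | @cons _ y _ h q =>
      refine ⟨y, fun _ => ⟨h, ?_⟩⟩
      have h1 : G.dist y r ≤ q.length := dist_le q
      have h3 : G.dist x r ≤ G.dist x y + G.dist y r := hconn.dist_triangle
      rw [dist_eq_one_iff_adj.2 h] at h3
      rw [Walk.length_cons] at hw
      rw [dist_comm (u := r), dist_comm (u := r)]
      omega
  choose p hp using hpar
  -- By maximality of the degree of `r`, the neighbors of `a` inject into those of `r`.
  have hcode : ∀ a, ∃ f : V → V, (∀ b, G.Adj a b → G.Adj r (f b)) ∧
      ∀ b c, G.Adj a b → G.Adj a c → f b = f c → b = c := by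
    intro a
    obtain ⟨f, hf, hinj⟩ := Finset.exists_subset_card_eq (hdeg a)
    obtain ⟨e⟩ : Nonempty (G.neighborFinset a ≃ f) := by
      rw [← Fintype.card_eq, Fintype.card_coe, Fintype.card_coe, hinj,
        card_neighborFinset_eq_degree]
    refine ⟨fun b => if h : b ∈ G.neighborFinset a then e ⟨b, h⟩ else b, ?_, ?_⟩
    · intro b hb
      have hb' : b ∈ G.neighborFinset a := by simpa using hb
      have := hf (e ⟨b, hb'⟩).2
      simpa [hb] using this
    · intro b c hb hc h
      have hb' : b ∈ G.neighborFinset a := by simpa using hb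
      have hc' : c ∈ G.neighborFinset a := by simpa using hc
      simp only [hb', hc', dif_pos] at h
      simpa using e.injective (Subtype.ext h)
  choose f hf hfi using hcode
  let σ : Fin (G.degree r) ≃ G.neighborFinset r :=
    ((G.neighborFinset r).equivFinOfCardEq (G.card_neighborFinset_eq_degree r)).symm
  refine ⟨⟨r, G.dist r, p, f, fun i => if h : i < G.degree r then σ ⟨i, h⟩ else r, G.degree r,
    fun x => ?_, fun x => dist_eq_one_iff_adj, fun x hx => (hp x hx).1, fun x hx => (hp x hx).2,
    hf, hfi, h2, ?_, ?_, ?_⟩⟩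
  · rw [hconn.dist_eq_zero_iff, eq_comm]
  · intro i hi
    rw [dif_pos hi]
    exact (G.mem_neighborFinset _ _).1 (σ ⟨i, hi⟩).2
  · intro i j hi hj h
    rw [dif_pos hi, dif_pos hj] at h
    simpa using σ.injective (Subtype.ext h)
  · intro s hs
    have hs' : s ∈ G.neighborFinset r := by simpa using hs
    refine ⟨(σ.symm ⟨s, hs'⟩).1, (σ.symm ⟨s, hs'⟩).2, ?_⟩
    rw [dif_pos (σ.symm ⟨s, hs'⟩).2]
    exact congrArg Subtype.val (σ.apply_symm_apply ⟨s, hs'⟩)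

end SimpleGraph

/-! ### Tuples, the link graph and its inclusion in the strong power. -/

namespace SimpleGraph.Rooting
variable {V : Type*} {G : SimpleGraph V} (R : G.Rooting) {k : ℕ}

/-- The tuple with the entry `a` at `m` and the root everywhere else. -/
def axis (m : Fin (k + 2)) (a : V) : Fin (k + 2) → V :=
  Function.update (fun _ => R.root) m a

/-- The tuple with the root everywhere. -/
def origin (k : ℕ) : Fin (k + 2) → V := fun _ => R.root

/-- The tuple `x` with its entry at `m` replaced by the parent. -/
def lower (x : Fin (k + 2) → V) (m : Fin (k + 2)) : Fin (k + 2) → V :=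
  Function.update x m (R.parent (x m))

/-- All entries are the root or neighbors of the root. -/
def IsNear (x : Fin (k + 2) → V) : Prop := ∀ i, R.depth (x i) ≤ 1

/-- Exactly one entry differs from the root. -/
def IsAxial (x : Fin (k + 2) → V) : Prop := ∃ m a, a ≠ R.root ∧ x = R.axis m a

/-- An enumeration of the axial near tuples in which consecutive ones lie on different axes. -/
def trail (k t : ℕ) : Fin (k + 2) → V :=
  R.axis (Fin.ofNat (k + 2) t) (R.enum (t / (k + 2)))

/-- The sum of the depths of the entries. -/
def total (x : Fin (k + 2) → V) : ℕ := ∑ i, R.depth (x i)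

/-- The near tuple with two non-root entries that marks the child `y` of its parent on the
axis `m`. -/
def mark (m : Fin (k + 2)) (y : V) : Fin (k + 2) → V :=
  Function.update (R.axis m (R.parent y)) (m + 1) (R.code (R.parent y) y)

/-- The edges of the rigid subgraph, in one orientation. -/
def Link (a b : Fin (k + 2) → V) : Prop :=
  (a = R.origin k ∧ b = R.trail k 0) ∨
  (∃ t, t + 1 < R.deg * (k + 2) ∧ a = R.trail k t ∧ b = R.trail k (t + 1)) ∨
  (R.IsNear a ∧ ¬ R.IsAxial a ∧ ∃ m, a m ≠ R.root ∧ b = R.axis m (a m)) ∨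
  (¬ R.IsNear a ∧ ∃ m, a m ≠ R.root ∧ b = R.lower a m) ∨
  (∃ m y, 2 ≤ R.depth y ∧ a = R.axis m y ∧ b = R.mark m y)

/-- The subgraph of the strong power that is singled out by the labeling. -/
def linkGraph (k : ℕ) : SimpleGraph (Fin (k + 2) → V) := fromRel R.Link

theorem axis_same (m : Fin (k + 2)) (a : V) : R.axis m a m = a := by simp [axis]

theorem axis_ne {m i : Fin (k + 2)} (h : i ≠ m) (a : V) : R.axis m a i = R.root := by
  simp [axis, h]

theorem axis_inj {m m' : Fin (k + 2)} {a a' : V} (ha : a ≠ R.root)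
    (h : R.axis m a = R.axis m' a') : m = m' ∧ a = a' := by
  have h1 := congrFun h m
  rw [axis_same] at h1
  by_cases hm : m = m'
  · subst hm
    exact ⟨rfl, by rw [h1, axis_same]⟩
  · rw [axis_ne _ hm] at h1
    exact absurd h1 ha

theorem depth_root : R.depth R.root = 0 := (R.depth_eq_zero _).2 rfl

theorem depth_pos {x : V} : 0 < R.depth x ↔ x ≠ R.root := by
  rw [Nat.pos_iff_ne_zero, ne_eq, R.depth_eq_zero]

theorem succ_ne (m : Fin (k + 2)) : m + 1 ≠ m := by simp

theorem isNear_origin : R.IsNear (R.origin k) := fun _ => by simp [origin, depth_root]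

theorem isNear_axis {m : Fin (k + 2)} {a : V} : R.IsNear (R.axis m a) ↔ R.depth a ≤ 1 := by
  constructor
  · intro h
    simpa [axis_same] using h m
  · intro h i
    by_cases hi : i = m
    · rw [hi, axis_same]; exact h
    · rw [axis_ne _ hi, depth_root]; omega

theorem isAxial_axis {m : Fin (k + 2)} {a : V} (ha : a ≠ R.root) : R.IsAxial (R.axis m a) :=
  ⟨m, a, ha, rfl⟩

theorem axis_ne_origin {m : Fin (k + 2)} {a : V} (ha : a ≠ R.root) :
    R.axis m a ≠ R.origin k := by
  intro h
  have := congrFun h m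
  rw [axis_same] at this
  exact ha this

theorem not_isAxial_of_two {x : Fin (k + 2) → V} {m l : Fin (k + 2)} (hml : m ≠ l)
    (hm : x m ≠ R.root) (hl : x l ≠ R.root) : ¬ R.IsAxial x := by
  rintro ⟨i, a, -, rfl⟩
  by_cases h : m = i
  · exact hl (R.axis_ne (h ▸ hml.symm) a)
  · exact hm (R.axis_ne h a)

theorem exists_two {x : Fin (k + 2) → V} (ho : x ≠ R.origin k) (hx : ¬ R.IsAxial x) :
    ∃ m l, m ≠ l ∧ x m ≠ R.root ∧ x l ≠ R.root := by
  obtain ⟨m, hm⟩ := Function.ne_iff.1 ho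
  by_contra! hcon
  refine hx ⟨m, x m, hm, funext fun i => ?_⟩
  by_cases hi : i = m
  · rw [hi, axis_same]
  · rw [axis_ne _ hi]
    exact hcon m i (Ne.symm hi) hm

theorem total_update (x : Fin (k + 2) → V) (m : Fin (k + 2)) (a : V) :
    R.total (Function.update x m a) + R.depth (x m) = R.total x + R.depth a := by
  unfold total
  rw [← Finset.add_sum_erase _ _ (Finset.mem_univ m),
    ← Finset.add_sum_erase _ (fun i => R.depth (x i)) (Finset.mem_univ m)]
  have : ∑ i ∈ Finset.univ.erase m, R.depth (Function.update x m a i) =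
      ∑ i ∈ Finset.univ.erase m, R.depth (x i) :=
    Finset.sum_congr rfl fun i hi => by
      rw [Function.update_of_ne (Finset.ne_of_mem_erase hi)]
  rw [this, Function.update_self]
  omega

theorem total_axis (m : Fin (k + 2)) (a : V) : R.total (R.axis m a) = R.depth a := by
  have := R.total_update (fun _ => R.root) m a
  have h0 : R.total (fun _ : Fin (k + 2) => R.root) = 0 := by simp [total, depth_root]
  rw [h0, depth_root] at this
  simpa [axis] using this

theorem total_lower {x : Fin (k + 2) → V} {m : Fin (k + 2)} (h : x m ≠ R.root) :
    R.total (R.lower x m) + 1 = R.total x := by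
  have := R.total_update x m (R.parent (x m))
  have h1 := R.depth_parent _ h
  unfold lower
  omega

theorem ne_root_of_two_le {y : V} (h : 2 ≤ R.depth y) : y ≠ R.root :=
  R.depth_pos.1 (by omega)

theorem parent_ne_root {y : V} (h : 2 ≤ R.depth y) : R.parent y ≠ R.root := by
  have := R.depth_parent y (R.ne_root_of_two_le h)
  exact R.depth_pos.1 (by omega)

theorem code_depth {y : V} (h : y ≠ R.root) : R.depth (R.code (R.parent y) y) = 1 :=
  (R.depth_eq_one _).2 (R.code_adj _ _ (R.adj_parent y h).symm)

theorem mark_succ (m : Fin (k + 2)) (y : V) : R.mark m y (m + 1) = R.code (R.parent y) y := by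
  simp [mark]

theorem mark_same (m : Fin (k + 2)) (y : V) : R.mark m y m = R.parent y := by
  rw [mark, Function.update_of_ne (succ_ne m).symm, axis_same]

theorem mark_succ_ne_root (m : Fin (k + 2)) {y : V} (h : y ≠ R.root) :
    R.mark m y (m + 1) ≠ R.root := by
  rw [mark_succ]
  exact R.depth_pos.1 (by rw [R.code_depth h]; omega)

theorem mark_not_isAxial (m : Fin (k + 2)) {y : V} (h : 2 ≤ R.depth y) :
    ¬ R.IsAxial (R.mark m y) :=
  R.not_isAxial_of_two (succ_ne m) (R.mark_succ_ne_root m (R.ne_root_of_two_le h))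
    (by rw [mark_same]; exact R.parent_ne_root h)

theorem mark_ne_origin (m : Fin (k + 2)) {y : V} (h : y ≠ R.root) :
    R.mark m y ≠ R.origin k := by
  intro h'
  exact R.mark_succ_ne_root m h (congrFun h' _)

/-- The parent loses one unit of depth and the code adds one. So a marking edge stays on its level,
unlike a lowering edge. The mark is near only when `y` has depth 2. -/
theorem total_mark (m : Fin (k + 2)) {y : V} (h : y ≠ R.root) :
    R.total (R.mark m y) = R.depth y := by
  have := R.total_update (R.axis m (R.parent y)) (m + 1) (R.code (R.parent y) y)
  rw [R.code_depth h, total_axis, axis_ne _ (succ_ne m), depth_root, R.depth_parent y h] at this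
  exact this

theorem div_lt {t : ℕ} (h : t < R.deg * (k + 2)) : t / (k + 2) < R.deg :=
  Nat.div_lt_of_lt_mul (by rwa [mul_comm])

theorem enum_ne_root {i : ℕ} (h : i < R.deg) : R.enum i ≠ R.root := (R.enum_adj i h).ne'

theorem trail_isAxial {t : ℕ} (h : t < R.deg * (k + 2)) : R.IsAxial (R.trail k t) :=
  R.isAxial_axis (R.enum_ne_root (R.div_lt h))

theorem trail_isNear {t : ℕ} (h : t < R.deg * (k + 2)) : R.IsNear (R.trail k t) :=
  R.isNear_axis.2 ((R.depth_eq_one _).2 (R.enum_adj _ (R.div_lt h))).le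

theorem trail_ne_origin {t : ℕ} (h : t < R.deg * (k + 2)) : R.trail k t ≠ R.origin k :=
  R.axis_ne_origin (R.enum_ne_root (R.div_lt h))

theorem trail_inj {s t : ℕ} (hs : s < R.deg * (k + 2)) (ht : t < R.deg * (k + 2))
    (h : R.trail k s = R.trail k t) : s = t := by
  obtain ⟨h1, h2⟩ := R.axis_inj (R.enum_ne_root (R.div_lt hs)) h
  have h3 := R.enum_inj _ _ (R.div_lt hs) (R.div_lt ht) h2
  have h4 : s % (k + 2) = t % (k + 2) := by simpa [Fin.ext_iff] using h1
  rw [← Nat.div_add_mod s (k + 2), ← Nat.div_add_mod t (k + 2), h3, h4]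

theorem exists_trail {x : Fin (k + 2) → V} (hn : R.IsNear x) (hx : R.IsAxial x) :
    ∃ t, t < R.deg * (k + 2) ∧ x = R.trail k t := by
  obtain ⟨m, a, ha, rfl⟩ := hx
  have h1 := R.isNear_axis.1 hn
  have h2 := R.depth_pos.2 ha
  obtain ⟨i, hi, rfl⟩ := R.enum_surj a ((R.depth_eq_one a).1 (by omega))
  have hm := m.2
  refine ⟨i * (k + 2) + m, by nlinarith, ?_⟩
  have e1 : (i * (k + 2) + m) / (k + 2) = i := by
    rw [mul_comm, Nat.mul_add_div (by omega), Nat.div_eq_of_lt hm, add_zero]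
  have e2 : Fin.ofNat (k + 2) (i * (k + 2) + m) = m := by
    ext
    simp [Fin.ofNat, Nat.mod_eq_of_lt hm]
  rw [trail, e1, e2]

theorem deg_mul_pos : 4 ≤ R.deg * (k + 2) := by
  have := R.two_le_deg
  nlinarith

theorem adj_origin {x : Fin (k + 2) → V} :
    (G.strongPower (k + 2)).Adj (R.origin k) x ↔ x ≠ R.origin k ∧ R.IsNear x := by
  have : ∀ a, (G.Adj R.root a ∨ R.root = a) ↔ R.depth a ≤ 1 := by
    intro a
    rw [← R.depth_eq_one, eq_comm (a := R.root), ← R.depth_eq_zero]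
    omega
  exact and_congr ne_comm (forall_congr' fun i => this (x i))

theorem Link.adj {a b : Fin (k + 2) → V} (h : R.Link a b) : (G.strongPower (k + 2)).Adj a b := by
  rcases h with ⟨rfl, rfl⟩ | ⟨t, ht, rfl, rfl⟩ | ⟨hn, hx, m, hm, rfl⟩ | ⟨hn, m, hm, rfl⟩ |
    ⟨m, y, hy, rfl, rfl⟩
  · have := R.deg_mul_pos (k := k)
    exact R.adj_origin.2 ⟨R.trail_ne_origin (by omega), R.trail_isNear (by omega)⟩
  -- Consecutive trail tuples lie on different axes, so each coordinate compares the root with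
  -- itself or with a neighbor.
  · have e : Fin.ofNat (k + 2) (t + 1) = Fin.ofNat (k + 2) t + 1 := by
      ext; simp [Fin.ofNat, Fin.val_add]
    refine ⟨fun h => by have := R.trail_inj (by omega) ht h; omega, fun i => ?_⟩
    by_cases h1 : i = Fin.ofNat (k + 2) t
    · subst h1
      left
      rw [trail, trail, axis_same, axis_ne _ (by rw [e]; exact (succ_ne _).symm)]
      exact (R.enum_adj _ (R.div_lt (by omega))).symm
    · rw [trail, axis_ne _ h1]
      by_cases h2 : i = Fin.ofNat (k + 2) (t + 1)
      · subst h2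
        left
        rw [trail, axis_same]
        exact R.enum_adj _ (R.div_lt ht)
      · right
        rw [trail, axis_ne _ h2]
  · refine ⟨fun h => hx (h ▸ R.isAxial_axis hm), fun i => ?_⟩
    by_cases hi : i = m
    · right; rw [hi, axis_same]
    · rw [axis_ne _ hi]
      have := hn i
      by_cases h0 : a i = R.root
      · exact .inr h0
      · have := R.depth_pos.2 h0
        exact .inl ((R.depth_eq_one _).1 (by omega)).symm
  · refine ⟨fun h => ?_, fun i => ?_⟩
    · have h1 := R.total_lower hm
      rw [← h] at h1
      omega
    · by_cases hi : i = m
      · left; rw [hi, lower, Function.update_self]; exact R.adj_parent _ hm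
      · right; rw [lower, Function.update_of_ne hi]
  · have h0 := R.ne_root_of_two_le hy
    refine ⟨fun h => R.mark_not_isAxial m hy (h ▸ R.isAxial_axis h0), fun i => ?_⟩
    by_cases h1 : i = m
    · left; rw [h1, mark_same, axis_same]; exact R.adj_parent _ h0
    · rw [axis_ne _ h1]
      by_cases h2 : i = m + 1
      · left; rw [h2, mark_succ]; exact R.code_adj _ _ (R.adj_parent y h0).symm
      · right; rw [mark, Function.update_of_ne h2, axis_ne _ h1]

theorem linkGraph_adj {a b : Fin (k + 2) → V} :
    (R.linkGraph k).Adj a b ↔ R.Link a b ∨ R.Link b a :=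
  ⟨fun h => h.2, fun h => ⟨h.elim (fun h => (h.adj R).ne) (fun h => (h.adj R).ne'), h⟩⟩

theorem linkGraph_le : R.linkGraph k ≤ G.strongPower (k + 2) := fun _ _ h =>
  h.2.elim (fun h => h.adj R) (fun h => (h.adj R).symm)

/-! ### Local structure of the link graph. -/

theorem parent_ne {a : V} (h : a ≠ R.root) : R.parent a ≠ a := by
  intro h'
  have := R.depth_parent a h
  rw [h'] at this
  omega

theorem lower_same (x : Fin (k + 2) → V) (m : Fin (k + 2)) : R.lower x m m = R.parent (x m) := by
  simp [lower]

theorem lower_ne {i m : Fin (k + 2)} (h : i ≠ m) (x : Fin (k + 2) → V) :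
    R.lower x m i = x i := by
  simp [lower, h]

/-- If `m' ≠ m`, the first equation makes `y m` the parent of `x m`; the second makes `x m` equal to
`y m` or to its parent. Depths forbid both. -/
theorem lower_index_eq {x y : Fin (k + 2) → V} {m l m' l' : Fin (k + 2)} (hml : m ≠ l)
    (hm : x m ≠ R.root) (hl' : y l' ≠ R.root)
    (h1 : R.lower y m' = R.lower x m) (h2 : R.lower y l' = R.lower x l) : m' = m := by
  by_contra hne
  have e1 := congrFun h1 m
  rw [lower_same, lower_ne _ (Ne.symm hne)] at e1
  have e2 := congrFun h2 m
  rw [lower_ne _ hml] at e2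
  by_cases h : m = l'
  · subst h
    rw [lower_same] at e2
    have d1 := R.depth_parent _ hm
    have d2 := R.depth_parent _ hl'
    rw [← e1] at d1
    rw [e2] at d2
    omega
  · rw [lower_ne _ h, e1] at e2
    exact R.parent_ne hm e2

/-- A tuple with at least two non-root entries is determined by two of its lower neighbors. -/
theorem eq_of_lower_eq {x y : Fin (k + 2) → V} {m l m' l' : Fin (k + 2)} (hml : m ≠ l)
    (hm : x m ≠ R.root) (hl : x l ≠ R.root) (hm' : y m' ≠ R.root) (hl' : y l' ≠ R.root)
    (h1 : R.lower y m' = R.lower x m) (h2 : R.lower y l' = R.lower x l) : y = x := by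
  have e1 := R.lower_index_eq hml hm hl' h1 h2
  have e2 := R.lower_index_eq hml.symm hl hm' h2 h1
  subst e1 e2
  funext i
  by_cases hi : i = m'
  · have := congrFun h2 i
    rwa [lower_ne _ (hi ▸ hml), lower_ne _ (hi ▸ hml)] at this
  · have := congrFun h1 i
    rwa [lower_ne _ hi, lower_ne _ hi] at this

theorem zero_lt_deg_mul : 0 < R.deg * (k + 2) := by
  have := R.deg_mul_pos (k := k)
  omega

theorem eq_trail_of_origin_adj {z : Fin (k + 2) → V} (h : (R.linkGraph k).Adj (R.origin k) z) :
    z = R.trail k 0 := by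
  rcases R.linkGraph_adj.1 h with h | h
  · rcases h with ⟨-, rfl⟩ | ⟨t, ht, h, -⟩ | ⟨-, -, m, hm, -⟩ | ⟨hn, -⟩ | ⟨m, y, hy, h, -⟩
    · rfl
    · exact absurd h.symm (R.trail_ne_origin (by omega))
    · exact absurd rfl hm
    · exact absurd R.isNear_origin hn
    · exact absurd h.symm (R.axis_ne_origin (R.ne_root_of_two_le hy))
  · rcases h with ⟨-, h⟩ | ⟨t, ht, -, h⟩ | ⟨-, -, m, hm, h⟩ | ⟨hn, m, hm, h⟩ | ⟨m, y, hy, -, h⟩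
    · exact absurd h.symm (R.trail_ne_origin R.zero_lt_deg_mul)
    · exact absurd h.symm (R.trail_ne_origin ht)
    · exact absurd h.symm (R.axis_ne_origin hm)
    -- A tuple that lowers to the origin has total depth 1, so it is near, but lowering edges start
    -- at far tuples.
    · refine absurd (fun i => ?_) hn
      have e := congrFun h i
      by_cases hi : i = m
      · subst hi
        rw [lower_same] at e
        have d := R.depth_parent _ hm
        rw [← e, origin, depth_root] at d
        omega
      · rw [lower_ne _ hi] at e
        rw [← e, origin, depth_root]
        omega
    · exact absurd h.symm (R.mark_ne_origin m (R.ne_root_of_two_le hy))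

/-- The tuple with the entries `a` at `m` and `b` at `l` and the root everywhere else. -/
def pair (m : Fin (k + 2)) (a : V) (l : Fin (k + 2)) (b : V) : Fin (k + 2) → V :=
  Function.update (R.axis m a) l b

theorem pair_right {m l : Fin (k + 2)} {a b : V} : R.pair m a l b l = b := by simp [pair]

theorem pair_isNear {m l : Fin (k + 2)} {a b : V} (ha : G.Adj R.root a) (hb : G.Adj R.root b) :
    R.IsNear (R.pair m a l b) := by
  intro i
  by_cases h : i = l
  · rw [h, R.pair_right, (R.depth_eq_one b).2 hb]
  · rw [pair, Function.update_of_ne h]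
    exact R.isNear_axis.2 ((R.depth_eq_one a).2 ha).le i

section pair
variable {m l : Fin (k + 2)} (hml : l ≠ m) {a b : V}
include hml

theorem pair_left : R.pair m a l b m = a := by
  rw [pair, Function.update_of_ne hml.symm, axis_same]

theorem pair_not_isAxial (ha : G.Adj R.root a) (hb : G.Adj R.root b) :
    ¬ R.IsAxial (R.pair m a l b) :=
  R.not_isAxial_of_two hml (by rw [R.pair_right]; exact hb.ne')
    (by rw [R.pair_left hml]; exact ha.ne')

theorem axis_adj_pair (ha : G.Adj R.root a) (hb : G.Adj R.root b) :
    (R.linkGraph k).Adj (R.axis m a) (R.pair m a l b) := by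
  refine R.linkGraph_adj.2 (.inr (.inr (.inr (.inl
    ⟨R.pair_isNear ha hb, R.pair_not_isAxial hml ha hb, m, ?_, ?_⟩))))
  · rw [R.pair_left hml]; exact ha.ne'
  · rw [R.pair_left hml]

end pair

theorem zero_lt_deg : 0 < R.deg := by have := R.two_le_deg; omega

theorem one_lt_deg : 1 < R.deg := R.two_le_deg

theorem enum_zero_ne_one : R.enum 0 ≠ R.enum 1 := fun h =>
  absurd (R.enum_inj 0 1 R.zero_lt_deg R.one_lt_deg h) (by omega)

theorem root_adj_of_isNear_axis {m : Fin (k + 2)} {a : V} (hn : R.IsNear (R.axis m a))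
    (ha : a ≠ R.root) : G.Adj R.root a := by
  have h1 := R.isNear_axis.1 hn
  have h2 := R.depth_pos.2 ha
  exact (R.depth_eq_one a).1 (by omega)

/-- Together with `eq_trail_of_origin_adj`, this characterizes the origin by its degree in the link
graph. -/
theorem exists_two_adj {x : Fin (k + 2) → V} (hx : x ≠ R.origin k) :
    ∃ z z', z ≠ z' ∧ (R.linkGraph k).Adj x z ∧ (R.linkGraph k).Adj x z' := by
  by_cases ha : R.IsAxial x
  · obtain ⟨m, a, ha, rfl⟩ := ha
    by_cases hn : R.IsNear (R.axis m a)
    · have hra := R.root_adj_of_isNear_axis hn ha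
      refine ⟨_, _, ?_, R.axis_adj_pair (succ_ne m) hra (R.enum_adj 0 R.zero_lt_deg),
        R.axis_adj_pair (succ_ne m) hra (R.enum_adj 1 R.one_lt_deg)⟩
      intro h
      have := congrFun h (m + 1)
      rw [R.pair_right, R.pair_right] at this
      exact R.enum_zero_ne_one this
    · have hd : 2 ≤ R.depth a := by rw [isNear_axis] at hn; omega
      have ham : R.axis m a m ≠ R.root := by rwa [axis_same]
      refine ⟨_, _, ?_, R.linkGraph_adj.2 (.inl (.inr (.inr (.inr (.inl ⟨hn, m, ham, rfl⟩))))),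
        R.linkGraph_adj.2 (.inl (.inr (.inr (.inr (.inr ⟨m, a, hd, rfl, rfl⟩)))))⟩
      intro h
      have h1 := R.total_lower ham
      rw [h, R.total_mark m ha, total_axis] at h1
      omega
  · obtain ⟨m, l, hml, hm, hl⟩ := R.exists_two hx ha
    by_cases hn : R.IsNear x
    · refine ⟨_, _, fun h => hml (R.axis_inj hm h).1,
        R.linkGraph_adj.2 (.inl (.inr (.inr (.inl ⟨hn, ha, m, hm, rfl⟩)))),
        R.linkGraph_adj.2 (.inl (.inr (.inr (.inl ⟨hn, ha, l, hl, rfl⟩))))⟩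
    · refine ⟨_, _, fun h => ?_,
        R.linkGraph_adj.2 (.inl (.inr (.inr (.inr (.inl ⟨hn, m, hm, rfl⟩))))),
        R.linkGraph_adj.2 (.inl (.inr (.inr (.inr (.inl ⟨hn, l, hl, rfl⟩)))))⟩
      have := congrFun h m
      rw [lower_same, lower_ne _ hml] at this
      exact R.parent_ne hm this

theorem eq_axis_of_adj {x z : Fin (k + 2) → V} (hn : R.IsNear x) (hx : ¬ R.IsAxial x)
    (ho : x ≠ R.origin k) (hz : R.IsNear z) (h : (R.linkGraph k).Adj x z) :
    ∃ m, x m ≠ R.root ∧ z = R.axis m (x m) := by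
  rcases R.linkGraph_adj.1 h with h | h
  · rcases h with ⟨h, -⟩ | ⟨t, ht, rfl, -⟩ | ⟨-, -, h⟩ | ⟨h, -⟩ | ⟨m, y, hy, rfl, -⟩
    · exact absurd h ho
    · exact absurd (R.trail_isAxial (by omega)) hx
    · exact h
    · exact absurd hn h
    · exact absurd (R.isAxial_axis (R.ne_root_of_two_le hy)) hx
  · rcases h with ⟨-, rfl⟩ | ⟨t, ht, -, rfl⟩ | ⟨-, -, m, hm, rfl⟩ | ⟨h, -⟩ | ⟨m, y, hy, rfl, -⟩
    · exact absurd (R.trail_isAxial R.zero_lt_deg_mul) hx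
    · exact absurd (R.trail_isAxial ht) hx
    · exact absurd (R.isAxial_axis hm) hx
    · exact absurd hz h
    · have := R.isNear_axis.1 hz
      omega

theorem adj_axis_iff {x : Fin (k + 2) → V} (hn : R.IsNear x) (hx : ¬ R.IsAxial x)
    (ho : x ≠ R.origin k) {m : Fin (k + 2)} {s : V} (hs : G.Adj R.root s) :
    (R.linkGraph k).Adj x (R.axis m s) ↔ x m = s := by
  constructor
  · intro h
    obtain ⟨m', hm', e⟩ := R.eq_axis_of_adj hn hx ho
      (R.isNear_axis.2 ((R.depth_eq_one s).2 hs).le) h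
    obtain ⟨rfl, rfl⟩ := R.axis_inj hs.ne' e
    rfl
  · rintro rfl
    exact R.linkGraph_adj.2 (.inl (.inr (.inr (.inl ⟨hn, hx, m, hs.ne', rfl⟩))))

/-- The trail is an induced path, so fixing one end can propagate along it. -/
theorem trail_adj {s t : ℕ} (hs : s < R.deg * (k + 2)) (ht : t < R.deg * (k + 2))
    (h : (R.linkGraph k).Adj (R.trail k s) (R.trail k t)) : t = s + 1 ∨ s = t + 1 := by
  have key : ∀ s t, s < R.deg * (k + 2) → t < R.deg * (k + 2) →
      R.Link (R.trail k s) (R.trail k t) → t = s + 1 := by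
    intro s t hs ht h
    rcases h with ⟨h, -⟩ | ⟨t', ht', h1, h2⟩ | ⟨-, h, -⟩ | ⟨h, -⟩ | ⟨m, y, hy, -, h⟩
    · exact absurd h (R.trail_ne_origin hs)
    · have := R.trail_inj hs (by omega) h1
      have := R.trail_inj ht ht' h2
      omega
    · exact absurd (R.trail_isAxial hs) h
    · exact absurd (R.trail_isNear hs) h
    · exact absurd (h ▸ R.trail_isAxial ht) (R.mark_not_isAxial m hy)
  exact (R.linkGraph_adj.1 h).imp (key _ _ hs ht) (key _ _ ht hs)

theorem trail_adj_succ {t : ℕ} (ht : t + 1 < R.deg * (k + 2)) :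
    (R.linkGraph k).Adj (R.trail k t) (R.trail k (t + 1)) :=
  R.linkGraph_adj.2 (.inl (.inr (.inl ⟨t, ht, rfl, rfl⟩)))

theorem adj_cases {x u : Fin (k + 2) → V} (hn : ¬ R.IsNear x) (h : (R.linkGraph k).Adj x u) :
    (∃ m, x m ≠ R.root ∧ u = R.lower x m) ∨ (∃ m, u m ≠ R.root ∧ x = R.lower u m) ∨
    (∃ m y, 2 ≤ R.depth y ∧ x = R.axis m y ∧ u = R.mark m y) ∨
    (∃ m y, 2 ≤ R.depth y ∧ u = R.axis m y ∧ x = R.mark m y) := by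
  rcases R.linkGraph_adj.1 h with h | h
  · rcases h with ⟨rfl, -⟩ | ⟨t, ht, rfl, -⟩ | ⟨h, -⟩ | ⟨-, h⟩ | h
    · exact absurd R.isNear_origin hn
    · exact absurd (R.trail_isNear (by omega)) hn
    · exact absurd h hn
    · exact .inl h
    · exact .inr (.inr (.inl h))
  · rcases h with ⟨-, rfl⟩ | ⟨t, ht, -, rfl⟩ | ⟨hu, -, m, hm, rfl⟩ | ⟨-, h⟩ | h
    · exact absurd (R.trail_isNear R.zero_lt_deg_mul) hn
    · exact absurd (R.trail_isNear ht) hn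
    · exact absurd (R.isNear_axis.2 (hu m)) hn
    · exact .inr (.inl h)
    · exact .inr (.inr (.inr h))

theorem eq_lower_of_adj {x u : Fin (k + 2) → V} (hn : ¬ R.IsNear x)
    (h : (R.linkGraph k).Adj x u) (ht : R.total u < R.total x) :
    ∃ m, x m ≠ R.root ∧ R.lower x m = u := by
  rcases R.adj_cases hn h with ⟨m, hm, rfl⟩ | ⟨m, hm, rfl⟩ | ⟨m, y, hy, rfl, rfl⟩ |
    ⟨m, y, hy, rfl, rfl⟩
  · exact ⟨m, hm, rfl⟩
  · have := R.total_lower hm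
    omega
  · rw [R.total_mark m (R.ne_root_of_two_le hy), total_axis] at ht
    omega
  · rw [R.total_mark m (R.ne_root_of_two_le hy), total_axis] at ht
    omega

theorem eq_mark_of_adj {x u : Fin (k + 2) → V} (hn : ¬ R.IsNear x) (hx : R.IsAxial x)
    (h : (R.linkGraph k).Adj x u) (ht : R.total u = R.total x) :
    ∃ m y, 2 ≤ R.depth y ∧ x = R.axis m y ∧ u = R.mark m y := by
  rcases R.adj_cases hn h with ⟨m, hm, rfl⟩ | ⟨m, hm, rfl⟩ | h | ⟨m, y, hy, -, rfl⟩
  · have := R.total_lower hm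
    omega
  · have := R.total_lower hm
    omega
  · exact h
  · exact absurd hx (R.mark_not_isAxial m hy)

theorem mark_inj {m m' : Fin (k + 2)} {y y' : V} (hm : m' = m) (hp : R.parent y' = R.parent y)
    (hy : 2 ≤ R.depth y) (hy' : 2 ≤ R.depth y') (h : R.mark m' y' = R.mark m y) : y' = y := by
  subst hm
  have e := congrFun h (m' + 1)
  rw [mark_succ, mark_succ, hp] at e
  exact R.code_inj (R.parent y) _ _ (hp ▸ (R.adj_parent _ (R.ne_root_of_two_le hy')).symm)
    (R.adj_parent _ (R.ne_root_of_two_le hy)).symm e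

/-! ### Telling axial from nonaxial near tuples by counting. -/

/-- The near neighbors of `x` in the link graph. -/
def nearNbrs (x : Fin (k + 2) → V) : Set (Fin (k + 2) → V) :=
  {z | R.IsNear z ∧ (R.linkGraph k).Adj x z}

theorem ncard_nearNbrs_le [Finite V] {x : Fin (k + 2) → V} (hn : R.IsNear x)
    (hx : ¬ R.IsAxial x) (ho : x ≠ R.origin k) : (R.nearNbrs x).ncard ≤ k + 2 := by
  have hsub : R.nearNbrs x ⊆ (fun m => R.axis m (x m)) '' Set.univ := by
    rintro z ⟨hz, hadj⟩
    obtain ⟨m, -, rfl⟩ := R.eq_axis_of_adj hn hx ho hz hadj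
    exact ⟨m, trivial, rfl⟩
  calc (R.nearNbrs x).ncard ≤ _ := Set.ncard_le_ncard hsub (Set.toFinite _)
    _ ≤ (Set.univ : Set (Fin (k + 2))).ncard := Set.ncard_image_le (Set.toFinite _)
    _ = k + 2 := by simp

theorem exists_trail_adj {t : ℕ} (ht : t < R.deg * (k + 2)) :
    ∃ s, s < R.deg * (k + 2) ∧ (R.linkGraph k).Adj (R.trail k t) (R.trail k s) := by
  by_cases h : t + 1 < R.deg * (k + 2)
  · exact ⟨t + 1, h, R.trail_adj_succ h⟩
  · have := R.deg_mul_pos (k := k)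
    obtain ⟨s, rfl⟩ : ∃ s, t = s + 1 := ⟨t - 1, by omega⟩
    exact ⟨s, by omega, (R.trail_adj_succ ht).symm⟩

theorem lt_ncard_nearNbrs [Finite V] {x : Fin (k + 2) → V} (hn : R.IsNear x)
    (hx : R.IsAxial x) : k + 2 < (R.nearNbrs x).ncard := by
  obtain ⟨t, ht, rfl⟩ := R.exists_trail hn hx
  obtain ⟨s, hs, hadj⟩ := R.exists_trail_adj ht
  obtain ⟨m, a, ha, hta⟩ := hx
  rw [hta] at hn hadj ⊢
  have hra := R.root_adj_of_isNear_axis hn ha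
  have h0 := R.enum_adj 0 R.zero_lt_deg
  have h1 := R.enum_adj 1 R.one_lt_deg
  -- One pair for each axis other than `m`; the free index `m` supplies a second pair on axis `m +
  -- 1`, using that the root has two neighbors. A trail neighbor brings the count to `k + 3`.
  let g : Fin (k + 2) → Fin (k + 2) → V := fun l =>
    if l = m then R.pair m a (m + 1) (R.enum 1) else R.pair m a l (R.enum 0)
  have hg : ∀ l, ∃ l' b, l' ≠ m ∧ G.Adj R.root b ∧ g l = R.pair m a l' b := by
    intro l
    by_cases hl : l = m
    · exact ⟨m + 1, _, succ_ne m, h1, if_pos hl⟩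
    · exact ⟨l, _, hl, h0, if_neg hl⟩
  have hpp : ∀ l l' b b', l ≠ m → b ≠ R.root →
      R.pair m a l b = R.pair m a l' b' → l = l' ∧ b = b' := by
    intro l l' b b' hl hb h
    have e := congrFun h l
    rw [R.pair_right] at e
    by_cases hll : l = l'
    · subst hll
      rw [R.pair_right] at e
      exact ⟨rfl, e⟩
    · rw [pair, Function.update_of_ne hll, axis_ne _ hl] at e
      exact absurd e hb
  have hginj : Function.Injective g := by
    intro l l' h
    by_cases hl : l = m <;> by_cases hl' : l' = m
    · rw [hl, hl']
    · simp only [g, if_pos hl, if_neg hl'] at h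
      exact absurd (hpp _ _ _ _ (succ_ne m) h1.ne' h).2 R.enum_zero_ne_one.symm
    · simp only [g, if_neg hl, if_pos hl'] at h
      exact absurd (hpp _ _ _ _ hl h0.ne' h).2 R.enum_zero_ne_one
    · simp only [g, if_neg hl, if_neg hl'] at h
      exact (hpp _ _ _ _ hl h0.ne' h).1
  have hmem : R.trail k s ∉ g '' Set.univ := by
    rintro ⟨l, -, hl⟩
    obtain ⟨l', b, hl', hb, e⟩ := hg l
    exact R.pair_not_isAxial hl' hra hb (e ▸ hl ▸ R.trail_isAxial hs)
  have hsub : insert (R.trail k s) (g '' Set.univ) ⊆ R.nearNbrs (R.axis m a) := by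
    rintro z (rfl | ⟨l, -, rfl⟩)
    · exact ⟨R.trail_isNear hs, hadj⟩
    · obtain ⟨l', b, hl', hb, e⟩ := hg l
      rw [e]
      exact ⟨R.pair_isNear hra hb, R.axis_adj_pair hl' hra hb⟩
  have hc := Set.ncard_le_ncard hsub (Set.toFinite _)
  rw [Set.ncard_insert_of_notMem hmem (Set.toFinite _), Set.ncard_image_of_injective _ hginj] at hc
  simpa using hc

/-! ### Rigidity of the strong power together with the link graph. -/

section rigidity
variable {φ : (Fin (k + 2) → V) ≃ (Fin (k + 2) → V)}
  (hX : ∀ x y, (G.strongPower (k + 2)).Adj (φ x) (φ y) ↔ (G.strongPower (k + 2)).Adj x y)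
  (hH : ∀ x y, (R.linkGraph k).Adj (φ x) (φ y) ↔ (R.linkGraph k).Adj x y)

include hH in
theorem map_origin : φ (R.origin k) = R.origin k := by
  by_contra hne
  obtain ⟨z, z', hzz, hz, hz'⟩ := R.exists_two_adj hne
  have key : ∀ z, (R.linkGraph k).Adj (φ (R.origin k)) z → φ.symm z = R.trail k 0 := by
    intro z hz
    refine R.eq_trail_of_origin_adj ((hH _ _).1 ?_)
    rwa [φ.apply_symm_apply]
  exact hzz (φ.symm.injective ((key z hz).trans (key z' hz').symm))

include hH in
theorem map_ne_origin {x : Fin (k + 2) → V} (hx : x ≠ R.origin k) : φ x ≠ R.origin k :=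
  fun h => hx (φ.injective (h.trans (R.map_origin hH).symm))

include hX hH in
theorem map_isNear {x : Fin (k + 2) → V} : R.IsNear (φ x) ↔ R.IsNear x := by
  by_cases hx : x = R.origin k
  · rw [hx, R.map_origin hH]
  · have h := hX (R.origin k) x
    rw [R.map_origin hH, adj_origin, adj_origin] at h
    simpa [hx, R.map_ne_origin hH hx] using h

include hX hH in
theorem ncard_nearNbrs_map (x : Fin (k + 2) → V) :
    (R.nearNbrs (φ x)).ncard = (R.nearNbrs x).ncard := by
  have : R.nearNbrs (φ x) = φ '' R.nearNbrs x := by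
    ext z
    obtain ⟨z, rfl⟩ := φ.surjective z
    rw [φ.injective.mem_set_image]
    exact and_congr (R.map_isNear hX hH) (hH _ _)
  rw [this, Set.ncard_image_of_injective _ φ.injective]

include hX hH in
theorem map_trail [Finite V] (t : ℕ) (ht : t < R.deg * (k + 2)) :
    φ (R.trail k t) = R.trail k t := by
  induction t using Nat.strong_induction_on with
  | _ t ih =>
  rcases t with _ | t
  · refine R.eq_trail_of_origin_adj ?_
    rw [← R.map_origin hH, hH]
    exact R.linkGraph_adj.2 (.inl (.inl ⟨rfl, rfl⟩))
  · have hn : R.IsNear (φ (R.trail k (t + 1))) := (R.map_isNear hX hH).2 (R.trail_isNear ht)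
    have hax : R.IsAxial (φ (R.trail k (t + 1))) := by
      by_contra hax
      have h1 := R.ncard_nearNbrs_le hn hax (R.map_ne_origin hH (R.trail_ne_origin ht))
      have h2 := R.lt_ncard_nearNbrs (R.trail_isNear ht) (R.trail_isAxial ht)
      rw [R.ncard_nearNbrs_map hX hH] at h1
      omega
    obtain ⟨s, hs, e⟩ := R.exists_trail hn hax
    have hadj := (hH _ _).2 (R.trail_adj_succ ht)
    rw [ih t (by omega) (by omega), e] at hadj
    rcases R.trail_adj (by omega) hs hadj with rfl | rfl
    · exact e
    -- The predecessor is already its own image, so injectivity excludes it.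
    · rw [← ih s (by omega) hs] at e
      have := R.trail_inj ht hs (φ.injective e)
      omega

include hX hH in
theorem map_of_isNear [Finite V] {x : Fin (k + 2) → V} (hn : R.IsNear x) : φ x = x := by
  have hfix : ∀ z, R.IsNear z → R.IsAxial z → φ z = z := by
    intro z hz haz
    obtain ⟨t, ht, rfl⟩ := R.exists_trail hz haz
    exact R.map_trail hX hH t ht
  by_cases hx : x = R.origin k
  · rw [hx, R.map_origin hH]
  by_cases ha : R.IsAxial x
  · exact hfix x hn ha
  have hn' := (R.map_isNear hX hH).2 hn
  have hx' := R.map_ne_origin hH hx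
  have ha' : ¬ R.IsAxial (φ x) := fun h => ha (φ.injective (hfix _ hn' h) ▸ h)
  -- Each non-root entry is read off from adjacency to a fixed axial tuple.
  have key : ∀ m s, G.Adj R.root s → (φ x m = s ↔ x m = s) := by
    intro m s hs
    rw [← R.adj_axis_iff hn ha hx hs, ← R.adj_axis_iff hn' ha' hx' hs,
      ← hH x, hfix _ (R.isNear_axis.2 ((R.depth_eq_one s).2 hs).le) (R.isAxial_axis hs.ne')]
  have hroot : ∀ z : Fin (k + 2) → V, R.IsNear z → ∀ m, z m ≠ R.root → G.Adj R.root (z m) := by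
    intro z hz m hm
    have h1 := R.depth_pos.2 hm
    have h2 := hz m
    exact (R.depth_eq_one _).1 (by omega)
  funext m
  by_cases h : x m = R.root
  · by_cases h' : φ x m = R.root
    · rw [h, h']
    · exact ((key m _ (hroot _ hn' m h')).1 rfl).symm
  · exact (key m _ (hroot _ hn m h)).2 rfl

include hX hH in
/-- The identity is the only permutation that preserves both the strong power and the link
graph. -/
theorem map_eq [Finite V] (x : Fin (k + 2) → V) : φ x = x := by
  suffices h : ∀ n x, R.total x ≤ n → φ x = x from h _ x le_rfl
  intro n
  induction n with
  | zero =>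
    intro x hx
    refine R.map_of_isNear hX hH fun i => ?_
    have : R.depth (x i) ≤ R.total x :=
      Finset.single_le_sum (f := fun i => R.depth (x i)) (fun _ _ => Nat.zero_le _)
        (Finset.mem_univ i)
    omega
  | succ n ih =>
    -- All lower levels are fixed pointwise, so injectivity keeps this level from dropping into
    -- them.
    have htot : ∀ x, R.total x = n + 1 → n < R.total (φ x) := by
      intro x hx
      by_contra! hle
      have := φ.injective (ih _ hle)
      rw [this] at hle
      omega
    have hlow : ∀ x, R.total x = n + 1 → ¬ R.IsNear x → ∀ m, x m ≠ R.root →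
        ∃ m', φ x m' ≠ R.root ∧ R.lower (φ x) m' = R.lower x m := by
      intro x hx hn m hm
      have h1 := R.total_lower hm
      have hadj : (R.linkGraph k).Adj x (R.lower x m) :=
        R.linkGraph_adj.2 (.inl (.inr (.inr (.inr (.inl ⟨hn, m, hm, rfl⟩)))))
      rw [← hH, ih (R.lower x m) (by omega)] at hadj
      have h2 := htot x hx
      exact R.eq_lower_of_adj (mt (R.map_isNear hX hH).1 hn) hadj (by omega)
    -- Nonaxial tuples come first within a level: the mark of an axial tuple is nonaxial on the same
    -- level and must already be fixed.
    have hnonax : ∀ x, R.total x = n + 1 → ¬ R.IsAxial x → φ x = x := by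
      intro x hx ha
      by_cases hn : R.IsNear x
      · exact R.map_of_isNear hX hH hn
      obtain ⟨m, l, hml, hm, hl⟩ :=
        R.exists_two (x := x) (fun h => hn (by rw [h]; exact R.isNear_origin)) ha
      obtain ⟨m', hm', e1⟩ := hlow x hx hn m hm
      obtain ⟨l', hl', e2⟩ := hlow x hx hn l hl
      exact R.eq_of_lower_eq hml hm hl hm' hl' e1 e2
    intro x hx
    rcases Nat.lt_or_ge (R.total x) (n + 1) with hlt | hge
    · exact ih x (by omega)
    have hx : R.total x = n + 1 := by omega
    by_cases hn : R.IsNear x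
    · exact R.map_of_isNear hX hH hn
    by_cases ha : R.IsAxial x
    swap
    · exact hnonax x hx ha
    have hn' := mt (R.map_isNear hX hH).1 hn
    obtain ⟨m, y, hy, rfl⟩ := ha
    have hd : 2 ≤ R.depth y := by rw [isNear_axis] at hn; omega
    obtain ⟨m', hm', e⟩ := hlow _ hx hn m (by rwa [axis_same])
    have htx : R.total (φ (R.axis m y)) = n + 1 := by
      rw [← R.total_lower hm', e, R.total_lower (by rwa [axis_same]), hx]
    have hax : R.IsAxial (φ (R.axis m y)) := by
      by_contra hax
      refine hax ?_
      -- A nonaxial image would itself be fixed, hence equal to the axial tuple it came from.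
      rw [φ.injective (hnonax _ htx hax)]
      exact R.isAxial_axis hy
    have hadj : (R.linkGraph k).Adj (R.axis m y) (R.mark m y) :=
      R.linkGraph_adj.2 (.inl (.inr (.inr (.inr (.inr ⟨m, y, hd, rfl, rfl⟩)))))
    have htm : R.total (R.mark m y) = n + 1 := by
      rw [R.total_mark m hy, ← R.total_axis m y, hx]
    rw [← hH, hnonax _ htm (R.mark_not_isAxial m hd)] at hadj
    obtain ⟨l, z, hz, e1, e2⟩ := R.eq_mark_of_adj hn' hax hadj (by omega)
    have hz0 := R.ne_root_of_two_le hz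
    rw [e1] at hm' e ⊢
    have hml' : m' = l := by
      by_contra h
      exact hm' (R.axis_ne h z)
    subst hml'
    have e' : ∀ (i : Fin (k + 2)) (a : V), R.lower (R.axis i a) i = R.axis i (R.parent a) := by
      intro i a
      rw [lower, axis_same, axis, Function.update_idem]
      rfl
    rw [e', e'] at e
    obtain ⟨h1, h2⟩ := R.axis_inj (R.parent_ne_root hz) e
    rw [h1, R.mark_inj h1 h2 hd hz e2.symm]

end rigidity

end SimpleGraph.Rooting

/-! ### From subgraphs to labelings, and the lower bound. -/

namespace SimpleGraph

/-- Label an edge by whether it belongs to the subgraph `H`. -/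
noncomputable def subgraphLabeling {V : Type*} (G H : SimpleGraph V) : G.EdgeLabeling (Fin 2) :=
  open Classical in fun e => if e.1 ∈ H.edgeSet then 1 else 0

theorem adj_iff_of_subgraphLabeling {V : Type*} {G H : SimpleGraph V} (hle : H ≤ G) {φ : G ≃g G}
    (hφ : ∀ e : G.edgeSet, G.subgraphLabeling H (φ.mapEdgeSet e) = G.subgraphLabeling H e)
    (x y : V) : H.Adj (φ x) (φ y) ↔ H.Adj x y := by
  by_cases h : G.Adj x y
  · have := hφ ⟨s(x, y), h⟩
    have hmap : (φ.mapEdgeSet ⟨s(x, y), h⟩).1 = s(φ x, φ y) := rfl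
    simp only [subgraphLabeling, hmap, mem_edgeSet] at this
    by_cases h1 : H.Adj (φ x) (φ y) <;> by_cases h2 : H.Adj x y <;> simp_all
  · exact iff_of_false (fun h' => h (φ.map_adj_iff.1 (hle h'))) fun h' => h (hle h')

/-- Permuting the coordinates is an automorphism of the strong power. -/
def strongPowerPerm {V : Type*} (G : SimpleGraph V) {k : ℕ} (σ : Equiv.Perm (Fin k)) :
    G.strongPower k ≃g G.strongPower k where
  toEquiv := σ.arrowCongr (Equiv.refl V)
  map_rel_iff' := by
    intro x y
    refine and_congr (not_congr (Equiv.apply_eq_iff_eq _)) ?_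
    exact σ.symm.forall_congr_left.trans (forall_congr' fun i => by simp)

theorem exists_strongPowerPerm_ne {V : Type*} [Nontrivial V] (G : SimpleGraph V) (k : ℕ) :
    ∃ φ : G.strongPower (k + 2) ≃g G.strongPower (k + 2), φ ≠ RelIso.refl _ := by
  obtain ⟨a, b, hab⟩ := exists_pair_ne V
  refine ⟨G.strongPowerPerm (Equiv.swap 0 1), fun h => ?_⟩
  have h1 := congrFun (DFunLike.congr_fun h (Function.update (fun _ => a) 0 b)) 0
  simp [strongPowerPerm, Equiv.arrowCongr] at h1
  exact hab h1

end SimpleGraph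

theorem mainTheorem1 {V : Type*} [Finite V] [Nontrivial V] (G : SimpleGraph V)
    (hconn : G.Connected) (hthin : G.IsSThin) (k : ℕ) (hk : 2 ≤ k) :
    (G.strongPower k).distinguishingIndex = 2 := by
  obtain ⟨k, rfl⟩ := Nat.exists_eq_add_of_le' hk
  obtain ⟨R⟩ := SimpleGraph.Rooting.nonempty_of_isSThin hconn hthin
  have hmem : 2 ∈ {d : ℕ | ∃ c : (G.strongPower (k + 2)).EdgeLabeling (Fin d),
      (G.strongPower (k + 2)).IsDistinguishingEdgeLabeling c} := by
    refine ⟨SimpleGraph.subgraphLabeling _ (R.linkGraph k), fun φ hφ => ?_⟩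
    ext1 x
    exact R.map_eq (φ := φ.toEquiv) (fun _ _ => φ.map_adj_iff)
      (SimpleGraph.adj_iff_of_subgraphLabeling R.linkGraph_le hφ) x
  refine le_antisymm (Nat.sInf_le hmem) (le_csInf ⟨2, hmem⟩ ?_)
  rintro d ⟨c, hc⟩
  -- With 0 or 1 labels every automorphism preserves the labeling, including a coordinate swap.
  by_contra! hd
  obtain ⟨φ, hφ⟩ := SimpleGraph.exists_strongPowerPerm_ne G k
  have : Subsingleton (Fin d) := Fin.subsingleton_iff_le_one.2 (by omega)
  exact hφ (hc φ fun _ => Subsingleton.elim _ _)
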